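/- **Theorem 2 (Witt vectors and free probability).** Let $\Sigma$ be the set of one-dimensional non-commutative distributions, i.e. linear functionals $\mu:\mathbb{C}[z]\to\mathbb{C}$ with $\mu(1)=1$, with moments $m_n=\mu(z^n)$, and let $\Sigma^\times_1\subset\Sigma$ be the set of those with mean $m_1=1$. For $\mu,\nu\in\Sigma$ there are free random variables $a,b$ in some non-commutative probability space over $\mathbb{C}$ with distributions $\mu,\nu$; the distributions of $a+b$ and $ab$ depend only on $\mu$ and $\nu$ and are denoted $\mu\boxplus_V\nu$ and $\mu\boxtimes_V\nu$. For $\mu\in\Sigma$ the series $R_V(\mu)\in\mathbb{C}[[z]]$ is defined by $G_\mu(R_V(\mu)(z)+1/z)=z$, where $G_\mu(w)=\sum_{n\ge0}m_nw^{-n-1}$. For $\mu\in\Sigma^\times_1$ let $S_V(\mu)(z)=\chi(z)\frac{1+z}{z}$, where $\chi$ is the compositional inverse of $\psi(z)=\sum_{n\ge1}m_nz^n$. Let $\Lambda(\mathbb{C})=1+z\mathbb{C}[[z]]$, with multiplication of series as addition, and with the multiplication $\ast$ determined by $\prod_i(1-a_iz)\ast\prod_j(1-b_jz)=\prod_{i,j}(1-a_ib_jz)$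 modulo every power of $z$ (each $f\in\Lambda(\mathbb{C})$ is, modulo $z^{n+1}$, a finite product $\prod_i(1-a_iz)$). Let $\star$ be the Hadamard (coefficientwise) product on $\mathbb{C}[[z]]$ and $\underline 1=\sum_{n\ge0}z^n$. Then $(\Lambda(\mathbb{C}),\cdot,\ast,1,1-z)$ and $(\mathbb{C}[[z]],+,\star,0,\underline1)$ are commutative unital rings, the maps $S_V:\Sigma_1^\times\to\Lambda(\mathbb{C})$, $R_V:\Sigma\to\mathbb{C}[[z]]$ and the ghost map $g=-\frac{d}{dz}\log:\Lambda(\mathbb{C})\to\mathbb{C}[[z]]$ are bijective, $\boxtimes_V$ maps $\Sigma_1^\times\times\Sigma_1^\times$ into $\Sigma_1^\times$, and the following hold. 1. With $\mu_1\circledast\mu_2:=S_V^{-1}(S_V(\mu_1)\ast S_V(\mu_2))$, the set $(\Sigma^\times_1,\boxtimes_V,\circledast)$ is a commutative unital ring, and $S_V$ is an isomorphism from it onto the ring $(\Lambda(\mathbb{C}),\cdot,\ast,1,1-z)$. 2. With $\mu_1\boxdot\mu_2:=R_V^{-1}(R_V(\mu_1)\star R_V(\mu_2))$, the set $(\Sigma,\boxplus_V,\boxdot)$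 is a commutative unital ring, and $R_V$ is an isomorphism from it onto the ring $(\mathbb{C}[[z]],+,\star,0,\underline1)$. 3. The maps $\mathrm{LOG}:=R_V^{-1}\circ g\circ S_V:\Sigma_1^\times\to\Sigma$ and $\mathrm{EXP}:=S_V^{-1}\circ g^{-1}\circ R_V:\Sigma\to\Sigma_1^\times$ are mutually inverse isomorphisms between the rings $(\Sigma^\times_1,\boxtimes_V,\circledast)$ and $(\Sigma,\boxplus_V,\boxdot)$. With $\frac{d}{dz}\log$ in place of $-\frac{d}{dz}\log$, the map $\mathrm{LOG}':=R_V^{-1}\circ\frac{d}{dz}\log\circ S_V$ is the negative of $\mathrm{LOG}$ in the group $(\Sigma,\boxplus_V)$; it is an isomorphism of groups $(\Sigma_1^\times,\boxtimes_V)\to(\Sigma,\boxplus_V)$, and $\mathrm{LOG}'(\mu\circledast\nu)$ is the negative of $\mathrm{LOG}'(\mu)\boxdot\mathrm{LOG}'(\nu)$ for all $\mu,\nu\in\Sigma_1^\times$. -/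

import Mathlib

universe u

noncomputable section

namespace FreeWitt

/-! ### Rings and ring isomorphisms given by explicit operations -/

/-- `(α, add, mul, zero, one)` is a commutative unital ring. -/
def IsCommUnitalRing {α : Type*} (add mul : α → α → α) (zero one : α) : Prop :=
  ∃ _ : CommRing α, (∀ x y : α, x + y = add x y) ∧ (∀ x y : α, x * y = mul x y) ∧
    (0 : α) = zero ∧ (1 : α) = one

/-- `f` is an isomorphism from `(α, add, mul, zero, one)` to `(β, add', mul', zero', one')`. -/
def IsRingIso {α β : Type*} (add mul : α → α → α) (zero one : α)
    (add' mul' : β → β → β) (zero' one' : β) (f : α → β) : Prop :=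
  Function.Bijective f ∧ (∀ x y, f (add x y) = add' (f x) (f y)) ∧
    (∀ x y, f (mul x y) = mul' (f x) (f y)) ∧ f zero = zero' ∧ f one = one'

/-! ### Distributions and free random variables -/

/-- The set `Σ` of one-dimensional non-commutative distributions: unital linear functionals on
`ℂ[z]`. -/
abbrev Law : Type := {μ : Polynomial ℂ →ₗ[ℂ] ℂ // μ 1 = 1}

/-- The `n`-th moment of a distribution. -/
def Law.moment (μ : Law) (n : ℕ) : ℂ := μ.1 (Polynomial.X ^ n)

/-- The set `Σ₁ˣ` of distributions with mean `1`. -/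
abbrev MeanOneLaw : Type := {μ : Law // μ.moment 1 = 1}

/-- The point mass at `a`. -/
def dirac (a : ℂ) : Law := ⟨(Polynomial.aeval a).toLinearMap, by simp⟩

instance : Nonempty Law := ⟨dirac 0⟩

/-- The distribution of the random variable `a` in the non-commutative probability space
`(A, φ)`. -/
def law {A : Type*} [Ring A] [Algebra ℂ A] (φ : A →ₗ[ℂ] ℂ) (hφ : φ 1 = 1) (a : A) : Law :=
  ⟨φ ∘ₗ (Polynomial.aeval a).toLinearMap, by simpa using hφ⟩

/-- Freeness of a family of unital subalgebras: `φ (x₁ ⋯ xₙ) = 0` whenever `n ≥ 1`,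
`φ (x₁) = ⋯ = φ (xₙ) = 0` and neighbouring factors come from different members of the family. -/
def AreFree {A ι : Type*} [Ring A] [Algebra ℂ A] (φ : A →ₗ[ℂ] ℂ)
    (B : ι → Subalgebra ℂ A) : Prop :=
  ∀ l : List (Σ i : ι, B i), l ≠ [] → l.IsChain (fun x y => x.1 ≠ y.1) →
    (∀ x ∈ l, φ (x.2 : A) = 0) → φ (l.map fun x => (x.2 : A)).prod = 0

/-- The random variables `a` and `b` are free, that is, the unital subalgebras they generate
are. -/
def FreePair {A : Type*} [Ring A] [Algebra ℂ A] (φ : A →ₗ[ℂ] ℂ) (a b : A) : Prop :=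
  AreFree φ fun i : Bool => Algebra.adjoin ℂ {cond i a b}

/-- `ρ` is the distribution of `a + b` for some free `a`, `b` with distributions `μ`, `ν`. -/
def IsFreeAddConv (μ ν ρ : Law) : Prop :=
  ∃ (A : Type) (_ : Ring A) (_ : Algebra ℂ A) (φ : A →ₗ[ℂ] ℂ) (hφ : φ 1 = 1) (a b : A),
    FreePair φ a b ∧ law φ hφ a = μ ∧ law φ hφ b = ν ∧ law φ hφ (a + b) = ρ

/-- `ρ` is the distribution of `a * b` for some free `a`, `b` with distributions `μ`, `ν`. -/
def IsFreeMulConv (μ ν ρ : Law) : Prop :=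
  ∃ (A : Type) (_ : Ring A) (_ : Algebra ℂ A) (φ : A →ₗ[ℂ] ℂ) (hφ : φ 1 = 1) (a b : A),
    FreePair φ a b ∧ law φ hφ a = μ ∧ law φ hφ b = ν ∧ law φ hφ (a * b) = ρ

/-- Additive free convolution `μ ⊞ ν`: the distribution of `a + b` for free `a`, `b` with
distributions `μ`, `ν`. -/
def boxplus (μ ν : Law) : Law := Classical.epsilon (IsFreeAddConv μ ν)

/-- Multiplicative free convolution `μ ⊠ ν`: the distribution of `a * b` for free `a`, `b` with
distributions `μ`, `ν`. -/
def boxtimes (μ ν : Law) : Law := Classical.epsilon (IsFreeMulConv μ ν)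

/-! ### Voiculescu's transforms -/

/-- `f / z` for a power series `f` without constant term. -/
def divX (f : PowerSeries ℂ) : PowerSeries ℂ :=
  PowerSeries.mk fun n => PowerSeries.coeff (n + 1) f

/-- The moment series `∑_{n ≥ 0} mₙ zⁿ`. -/
def momentSeries (μ : Law) : PowerSeries ℂ := PowerSeries.mk μ.moment

theorem moment_zero (μ : Law) : μ.moment 0 = 1 := by
  simpa [Law.moment] using μ.2

theorem isUnit_coeff_one_cauchy (μ : Law) :
    IsUnit (PowerSeries.coeff 1 (PowerSeries.X * momentSeries μ)) := by
  rw [show (1 : ℕ) = 0 + 1 from rfl, PowerSeries.coeff_succ_X_mul]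
  simp [momentSeries, moment_zero]

/-- The `R`-transform. If `G(w) = ∑ mₙ w⁻⁽ⁿ⁺¹⁾` is the Cauchy transform, then
`G(R(z) + 1/z) = z`; since `G(1/v) = v ∑ mₙ vⁿ`, this says that `u(z) = 1 / (R(z) + 1/z)` is the
compositional inverse of `v ∑ mₙ vⁿ`, so that `1 + z R(z) = (u(z)/z)⁻¹`. -/
def RTransform (μ : Law) : PowerSeries ℂ :=
  divX (divX ((PowerSeries.X * momentSeries μ).substInvOfIsUnit
    (isUnit_coeff_one_cauchy μ)))⁻¹

/-- `ψ(z) = ∑_{n ≥ 1} mₙ zⁿ`. -/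
def psi (μ : Law) : PowerSeries ℂ := momentSeries μ - 1

theorem coeff_one_psi (μ : MeanOneLaw) : PowerSeries.coeff 1 (psi μ.1) = 1 := by
  simp [psi, momentSeries, PowerSeries.coeff_one, μ.2]

theorem isUnit_coeff_one_psi (μ : MeanOneLaw) : IsUnit (PowerSeries.coeff 1 (psi μ.1)) := by
  rw [coeff_one_psi]; exact isUnit_one

/-- The underlying set of `Λ(ℂ)`: power series with constant term `1`. -/
abbrev Lam : Type := {f : PowerSeries ℂ // PowerSeries.constantCoeff f = 1}

/-- The `S`-transform `S(z) = χ(z) (1 + z) / z`, where `χ` is the compositional inverse of `ψ`. -/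
def STransform (μ : MeanOneLaw) : Lam :=
  ⟨(1 + PowerSeries.X) * divX ((psi μ.1).substInvOfIsUnit (isUnit_coeff_one_psi μ)), by
    have h : ((isUnit_coeff_one_psi μ).unit⁻¹ : ℂˣ) = 1 := by
      rw [inv_eq_one]; ext; simpa using coeff_one_psi μ
    simp [divX, h]⟩

/-! ### The ring `Λ(ℂ)` and the ghost map -/

/-- The addition of `Λ(ℂ)`: multiplication of power series. -/
def lamAdd (f g : Lam) : Lam := ⟨f.1 * g.1, by simp [f.2, g.2]⟩

/-- The zero element of `Λ(ℂ)`: the constant series `1`. -/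
def lamZero : Lam := ⟨1, by simp⟩

/-- The unit element of `Λ(ℂ)`: the series `1 - z`. -/
def lamOne : Lam := ⟨1 - PowerSeries.X, by simp⟩

/-- For `f` with constant term `1`, the truncation of `f` after degree `n` factors over `ℂ` as
`∏ (1 - a z)`; this is the finite multiset of the numbers `a`. -/
def charRoots (n : ℕ) (f : PowerSeries ℂ) : Multiset ℂ :=
  (PowerSeries.trunc (n + 1) f).reverse.roots

/-- The multiplication `∗` of `Λ(ℂ)`: if `f ≡ ∏ᵢ (1 - aᵢ z)` and `g ≡ ∏ⱼ (1 - bⱼ z)` modulo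
`zⁿ⁺¹`, then `f ∗ g ≡ ∏ᵢⱼ (1 - aᵢ bⱼ z)` modulo `zⁿ⁺¹`. -/
def lamMul (f g : Lam) : Lam :=
  ⟨PowerSeries.mk fun n => PowerSeries.coeff n
    (((charRoots n f.1 ×ˢ charRoots n g.1).map
      fun p => 1 - PowerSeries.C (p.1 * p.2) * PowerSeries.X).prod), by
    rw [← PowerSeries.coeff_zero_eq_constantCoeff_apply, PowerSeries.coeff_mk,
      PowerSeries.coeff_zero_eq_constantCoeff_apply, map_multiset_prod, Multiset.map_map]
    simp⟩

/-- The logarithmic derivative `d/dz log f`. -/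
def dlog (f : Lam) : PowerSeries ℂ := PowerSeries.derivative ℂ (PowerSeries.logOf f.1)

/-- The ghost map `f ↦ - d/dz log f`, sending `∏ (1 - a z)` to the series of power sums
`∑_{n ≥ 0} (∑ aⁿ⁺¹) zⁿ`. -/
def ghost (f : Lam) : PowerSeries ℂ := - dlog f

/-- The Hadamard multiplication on `ℂ[[z]]`. -/
def hadamard (f g : PowerSeries ℂ) : PowerSeries ℂ :=
  PowerSeries.mk fun n => PowerSeries.coeff n f * PowerSeries.coeff n g

/-- The unit `1 + z + z² + ⋯` of the Hadamard multiplication. -/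
def hadamardOne : PowerSeries ℂ := PowerSeries.mk fun _ => 1

end FreeWitt

end

open FreeWitt

namespace FreeWitt

section Lambda

open PowerSeries

/-! ### Transport of rings -/

/-! Everything is transported to the Hadamard ring, which is just `ℂ^ℕ`. On `Λ(ℂ)` the series `dlog
f` solves `dlog f * f = f'`, so it is determined by `f` and determines it degree by degree. On
finite products the ghost coefficients are power sums, which add under multiplication and multiply
under `∗`; every series is such a product up to any given degree. Hence `ghost` is a bijection
carrying both operations of `Λ(ℂ)` to those of `ℂ[[z]]` (`ghost_lamAdd`, `ghost_lamMul`).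

Free convolutions depend only on the marginals because alternating words in centred polynomials span
the free algebra, and freeness fixes the state on them (`FreePair.apply_lift_eq`).

The transforms are computed on models in the full Fock space. With `ℓ` a creation operator and `ℓ*`
the annihilation operator, `ℓ + f(ℓ*)` has `R`-transform `f` and `(1 + ℓ) f(ℓ*)` has `S`-transform
`1/f`; models on different letters are free. Let `ω = ∑ zⁿ Kⁿ vac` with `K = ℓ₁ + ℓ₂` for sums, and
`1 + K = (1 + ℓ₁)(1 + ℓ₂)` for products. Annihilation operators act on `ω` (or on `(1 + ℓ₂) ω`) as
the scalar `z`, so power series in them act as scalars, and `z K ω = ω - vac`. Hence the operator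
`a` under study satisfies `z a ω = h ω - d vac` with scalar series `h`, `d`. Solving for the moments
(`subst_mk_mul_eq`) yields the compositional inverse, so that `R` is additive under `⊞` and `S`
multiplicative under `⊠`; the models also give surjectivity. -/

theorem IsCommUnitalRing.of_equiv {α β : Type*} {add mul : α → α → α} {add' mul' : β → β → β}
    {zero' one' : β} (e : α ≃ β) (h : IsCommUnitalRing add' mul' zero' one')
    (hadd : ∀ x y, e (add x y) = add' (e x) (e y))
    (hmul : ∀ x y, e (mul x y) = mul' (e x) (e y)) :
    IsCommUnitalRing add mul (e.symm zero') (e.symm one') := by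
  obtain ⟨inst, ha, hm, rfl, rfl⟩ := h
  refine ⟨e.commRing, fun x y => ?_, fun x y => ?_, rfl, rfl⟩
  · exact (e.symm_apply_eq.2 ((hadd x y).trans (ha _ _).symm).symm)
  · exact (e.symm_apply_eq.2 ((hmul x y).trans (hm _ _).symm).symm)

theorem IsRingIso.trans {α β γ : Type*} {add mul : α → α → α} {zero one : α}
    {add' mul' : β → β → β} {zero' one' : β} {add'' mul'' : γ → γ → γ} {zero'' one'' : γ}
    {f : α → β} {g : β → γ} (hf : IsRingIso add mul zero one add' mul' zero' one' f)
    (hg : IsRingIso add' mul' zero' one' add'' mul'' zero'' one'' g) :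
    IsRingIso add mul zero one add'' mul'' zero'' one'' (g ∘ f) :=
  ⟨hg.1.comp hf.1, fun x y => by simp [hf.2.1, hg.2.1], fun x y => by simp [hf.2.2.1, hg.2.2.1],
    by simp [hf.2.2.2.1, hg.2.2.2.1], by simp [hf.2.2.2.2, hg.2.2.2.2]⟩

theorem IsRingIso.symm {α β : Type*} {add mul : α → α → α} {zero one : α}
    {add' mul' : β → β → β} {zero' one' : β} {e : α ≃ β}
    (h : IsRingIso add mul zero one add' mul' zero' one' e) :
    IsRingIso add' mul' zero' one' add mul zero one e.symm :=
  ⟨e.symm.bijective, fun x y => by simp [e.symm_apply_eq, h.2.1],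
    fun x y => by simp [e.symm_apply_eq, h.2.2.1],
    by simp [e.symm_apply_eq, h.2.2.2.1], by simp [e.symm_apply_eq, h.2.2.2.2]⟩

theorem isCommUnitalRing_hadamard :
    IsCommUnitalRing (fun f g : PowerSeries ℂ => f + g) hadamard 0 hadamardOne := by
  let e : PowerSeries ℂ ≃ (ℕ → ℂ) :=
    { toFun := fun f n => coeff n f
      invFun := PowerSeries.mk
      left_inv := fun f => by ext; simp
      right_inv := fun f => by ext; simp }
  exact IsCommUnitalRing.of_equiv (add' := (· + ·)) (mul' := (· * ·)) (zero' := 0) (one' := 1) e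
    ⟨inferInstance, fun _ _ => rfl, fun _ _ => rfl, rfl, rfl⟩
    (fun f g => by ext; simp [e]) (fun f g => by ext; simp [e, hadamard])

/-! ### The logarithmic derivative -/

/-- Chain rule, from `(log (1 + z))' (1 + z) = 1` evaluated at `f - 1`. All later facts about `dlog`
come from this linear differential equation. -/
theorem dlog_mul_self (f : Lam) : dlog f * f.1 = PowerSeries.derivative ℂ f.1 := by
  have hs : HasSubst (f.1 - 1) := HasSubst.of_constantCoeff_zero' (by simp [f.2])
  have hgeom : PowerSeries.derivative ℂ (PowerSeries.log ℂ) * (1 + X) = 1 := by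
    rw [deriv_log]
    ext n
    rcases n with _ | n
    · simp
    · simp [mul_add, coeff_succ_mul_X, pow_succ, coeff_one]
  have h := congrArg (fun p : PowerSeries ℂ => p.subst (f.1 - 1)) hgeom
  simp only [subst_mul hs, subst_add hs, subst_X hs] at h
  have h1 : (1 : PowerSeries ℂ).subst (f.1 - 1) = 1 := by
    rw [← coe_substAlgHom hs, map_one]
  rw [h1, add_sub_cancel] at h
  rw [dlog, logOf_eq, derivative_subst hs, mul_right_comm, h]
  simp

theorem Lam.ne_zero (f : Lam) : f.1 ≠ 0 := by
  intro h
  have := f.2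
  simp [h] at this

theorem dlog_eq_iff (f : Lam) (g : PowerSeries ℂ) :
    dlog f = g ↔ g * f.1 = PowerSeries.derivative ℂ f.1 := by
  rw [← dlog_mul_self f]
  exact ⟨fun h => by rw [h], fun h => (mul_right_cancel₀ f.ne_zero h).symm⟩

theorem dlog_lamAdd (f g : Lam) : dlog (lamAdd f g) = dlog f + dlog g := by
  rw [dlog_eq_iff, lamAdd, Derivation.leibniz, ← dlog_mul_self, ← dlog_mul_self]
  simp only [smul_eq_mul]
  ring

theorem ghost_lamAdd (f g : Lam) : ghost (lamAdd f g) = ghost f + ghost g := by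
  rw [ghost, dlog_lamAdd, ghost, ghost]
  ring

theorem ghost_lamOne : ghost lamOne = hadamardOne := by
  rw [ghost, neg_eq_iff_eq_neg, dlog_eq_iff]
  have h : hadamardOne * (1 - X) = 1 := by
    ext n
    rcases n with _ | n
    · simp [hadamardOne]
    · simp [hadamardOne, mul_sub, coeff_succ_mul_X, coeff_one]
  simp [lamOne, h]

/-- Newton's identities: the coefficient of degree `m` in `dlog f * f = f'` expresses `(m + 1) fₘ₊₁`
through lower coefficients of `f` and those of `dlog f` up to degree `m`. -/
theorem coeff_eq_of_coeff_dlog_eq {f g : Lam} {n : ℕ}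
    (h : ∀ k < n, coeff k (dlog f) = coeff k (dlog g)) :
    ∀ m ≤ n, coeff m f.1 = coeff m g.1 := by
  intro m
  induction m using Nat.strong_induction_on with
  | _ m ih =>
    intro hm
    rcases m with _ | m
    · simp [f.2, g.2]
    · have h1 := congrArg (coeff m) (dlog_mul_self f)
      have h2 := congrArg (coeff m) (dlog_mul_self g)
      rw [coeff_derivative, coeff_mul] at h1 h2
      have h3 : (m + 1 : ℂ) ≠ 0 := by exact_mod_cast m.succ_ne_zero
      apply mul_right_cancel₀ h3
      rw [← h1, ← h2]
      refine Finset.sum_congr rfl fun p hp => ?_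
      have := Finset.HasAntidiagonal.mem_antidiagonal.1 hp
      rw [h _ (by omega), ih _ (by omega) (by omega)]

theorem coeff_dlog_eq_of_coeff_eq {f g : Lam} {n : ℕ}
    (h : ∀ m ≤ n, coeff m f.1 = coeff m g.1) :
    ∀ k < n, coeff k (dlog f) = coeff k (dlog g) := by
  intro k hk
  induction k using Nat.strong_induction_on with
  | _ k ih =>
    have h1 := congrArg (coeff k) (dlog_mul_self f)
    have h2 := congrArg (coeff k) (dlog_mul_self g)
    rw [coeff_derivative, coeff_mul, Finset.Nat.sum_antidiagonal_eq_sum_range_succ_mk,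
      Finset.sum_range_succ] at h1 h2
    simp only [Nat.sub_self, coeff_zero_eq_constantCoeff, f.2, g.2, mul_one] at h1 h2
    have h3 : ∑ i ∈ Finset.range k, coeff i (dlog f) * coeff (k - i) f.1 =
        ∑ i ∈ Finset.range k, coeff i (dlog g) * coeff (k - i) g.1 := by
      refine Finset.sum_congr rfl fun i hi => ?_
      have := Finset.mem_range.1 hi
      rw [ih i (by omega) (by omega), h _ (by omega)]
    rw [← h (k + 1) (by omega)] at h2
    linear_combination h1 - h2 - h3

theorem dlog_injective : Function.Injective dlog := by
  intro f g h
  ext n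
  exact coeff_eq_of_coeff_dlog_eq (n := n) (fun k _ => by rw [h]) n le_rfl

theorem dlog_surjective : Function.Surjective dlog := by
  intro g
  -- The antiderivative of `g`. For `n = 0` the quotient is a division by zero, hence `0`, so `G`
  -- has no constant term and can be substituted into `exp`.
  let G : PowerSeries ℂ := PowerSeries.mk fun n => coeff (n - 1) g / n
  have hG : PowerSeries.derivative ℂ G = g := by
    ext n
    have h3 : (n + 1 : ℂ) ≠ 0 := by exact_mod_cast n.succ_ne_zero
    simp [G, coeff_derivative, h3]
  have hG0 : constantCoeff G = 0 := by
    rw [← coeff_zero_eq_constantCoeff_apply]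
    simp [G, -coeff_zero_eq_constantCoeff]
  have hs : HasSubst G := HasSubst.of_constantCoeff_zero' hG0
  have h1 : constantCoeff ((PowerSeries.exp ℂ).subst G) = 1 := by
    have h2 : constantCoeff ((PowerSeries.exp ℂ - 1).subst G) = 0 :=
      constantCoeff_subst_eq_zero hG0 _ (by simp)
    rw [subst_sub hs, ← coe_substAlgHom hs, map_one, map_sub, sub_eq_zero] at h2
    simpa [coe_substAlgHom hs] using h2
  refine ⟨⟨(PowerSeries.exp ℂ).subst G, h1⟩, (dlog_eq_iff _ _).2 ?_⟩
  simp only [derivative_subst hs, derivative_exp, hG, mul_comm]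

theorem ghost_bijective : Function.Bijective ghost :=
  (Equiv.neg (PowerSeries ℂ)).bijective.comp ⟨dlog_injective, dlog_surjective⟩

/-- The ghost map as a bijection. -/
noncomputable def ghostEquiv : Lam ≃ PowerSeries ℂ := Equiv.ofBijective ghost ghost_bijective

/-! ### Finite products `∏ (1 - a z)` -/

/-- The element `∏ (1 - a z)` of `Λ(ℂ)`. -/
noncomputable def lamProd (s : Multiset ℂ) : Lam :=
  ⟨(s.map fun a => 1 - C a * X).prod, by
    rw [map_multiset_prod, Multiset.map_map]
    simp⟩

theorem coeff_ghost_lamProd (s : Multiset ℂ) (k : ℕ) :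
    coeff k (ghost (lamProd s)) = (s.map fun a => a ^ (k + 1)).sum := by
  induction s using Multiset.induction_on with
  | empty =>
    have h : dlog (lamProd 0) = 0 := by simp [dlog_eq_iff, lamProd]
    simp [ghost, h]
  | cons a s ih =>
    have h0 : lamProd (a ::ₘ s) = lamAdd (lamProd {a}) (lamProd s) := by
      simp [lamProd, lamAdd]
    have h1 : dlog (lamProd {a}) = -PowerSeries.mk fun n => a ^ (n + 1) := by
      rw [dlog_eq_iff]
      have h : (PowerSeries.mk fun n => a ^ (n + 1)) * (1 - C a * X) = C a := by
        ext n
        rcases n with _ | n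
        · simp
        · simp [mul_sub, mul_left_comm, coeff_C_mul, coeff_succ_mul_X]
          ring
      simp [lamProd, h]
    rw [h0, ghost_lamAdd, map_add, ih, ghost, h1]
    simp

/-- The reversed polynomial is monic because `p` has constant term `1`, so it splits as `∏ (X - a)`.
Reversing again recovers `p`, again because its constant term is nonzero. -/
theorem eq_reverse_prod_of_coeff_zero_eq_one (p : Polynomial ℂ) (hp : p.coeff 0 = 1) :
    p = (p.reverse.roots.map fun a => 1 - Polynomial.C a * Polynomial.X).prod := by
  have key : ∀ s : Multiset ℂ, ((s.map fun a => Polynomial.X - Polynomial.C a).prod).reverse =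
      (s.map fun a => 1 - Polynomial.C a * Polynomial.X).prod := by
    intro s
    induction s using Multiset.induction_on with
    | empty => simpa using Polynomial.reverse_C (1 : ℂ)
    | cons a s ih =>
      rw [Multiset.map_cons, Multiset.prod_cons, Polynomial.reverse_mul_of_domain, ih,
        Multiset.map_cons, Multiset.prod_cons]
      congr 1
      rw [Polynomial.reverse, Polynomial.natDegree_X_sub_C, Polynomial.reflect_sub,
        Polynomial.reflect_one_X, Polynomial.reflect_C, pow_one]
  have h0 : p.natTrailingDegree = 0 := Polynomial.natTrailingDegree_eq_zero.2 (Or.inr (by simp [hp]))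
  have hm : p.reverse.Monic := by
    rw [Polynomial.Monic, Polynomial.reverse_leadingCoeff, Polynomial.trailingCoeff, h0, hp]
  have h1 := (IsAlgClosed.splits p.reverse).eq_prod_roots_of_monic hm
  rw [← key, ← h1, Polynomial.reverse, Polynomial.reverse_natDegree, h0, Nat.sub_zero,
    Polynomial.reverse, Polynomial.reflect_reflect]

theorem coeff_lamProd_charRoots (f : Lam) (n m : ℕ) (h : m ≤ n) :
    coeff m (lamProd (charRoots n f.1)).1 = coeff m f.1 := by
  have h1 := eq_reverse_prod_of_coeff_zero_eq_one (trunc (n + 1) f.1)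
    (by simp [coeff_trunc, f.2])
  have h2 : (lamProd (charRoots n f.1)).1 = (trunc (n + 1) f.1 : Polynomial ℂ) := by
    conv_rhs => rw [h1]
    rw [← Polynomial.coeToPowerSeries.ringHom_apply, map_multiset_prod, Multiset.map_map]
    simp [lamProd, charRoots, Function.comp_def]
  rw [h2, coeff_coe_trunc_of_lt (by omega)]

/-- Compared with the `h` whose ghost is the Hadamard product, degree by degree: up to degree `n`
only ghost coefficients below `n` matter. There `f` and `g` may be replaced by finite products, and
the power sums of the `aᵢ bⱼ` factor. -/
theorem ghost_lamMul (f g : Lam) : ghost (lamMul f g) = hadamard (ghost f) (ghost g) := by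
  obtain ⟨h, hh⟩ := ghost_bijective.2 (hadamard (ghost f) (ghost g))
  rw [← hh]
  congr 1
  ext n
  have hpow : ∀ (f : Lam), ∀ k < n,
      coeff k (ghost f) = ((charRoots n f.1).map fun a => a ^ (k + 1)).sum := by
    intro f k hk
    rw [← coeff_ghost_lamProd, ghost, ghost, map_neg, map_neg,
      coeff_dlog_eq_of_coeff_eq (coeff_lamProd_charRoots f n) k hk]
  have h1 : coeff n (lamMul f g).1 = coeff n
      (lamProd ((charRoots n f.1 ×ˢ charRoots n g.1).map fun p => p.1 * p.2)).1 := by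
    simp [lamMul, lamProd, Multiset.map_map]
  rw [h1]
  refine coeff_eq_of_coeff_dlog_eq (n := n) (fun k hk => ?_) n le_rfl
  have h2 : coeff k (ghost h) = coeff k (ghost f) * coeff k (ghost g) := by
    rw [hh]; simp [hadamard]
  rw [← neg_inj, ← map_neg, ← map_neg, ← ghost, ← ghost, h2, coeff_ghost_lamProd,
    hpow f k hk, hpow g k hk, Multiset.map_map]
  simp only [Function.comp_def, mul_pow]
  induction charRoots n f.1 using Multiset.induction_on with
  | empty => simp
  | cons a s ih =>
    simp only [Multiset.cons_product, Multiset.map_add, Multiset.sum_add, ih, Multiset.map_map,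
      Multiset.map_cons, Multiset.sum_cons, add_mul, Function.comp_def, Multiset.sum_map_mul_left]


theorem ghost_lamZero : ghost lamZero = 0 := by
  rw [ghost, neg_eq_zero, dlog_eq_iff]
  simp [lamZero]

theorem isCommUnitalRing_lam : IsCommUnitalRing lamAdd lamMul lamZero lamOne := by
  have h := IsCommUnitalRing.of_equiv (add := lamAdd) (mul := lamMul) ghostEquiv
    isCommUnitalRing_hadamard ghost_lamAdd ghost_lamMul
  rwa [show ghostEquiv.symm 0 = lamZero from ghostEquiv.symm_apply_eq.2 ghost_lamZero.symm,
    show ghostEquiv.symm hadamardOne = lamOne from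
      ghostEquiv.symm_apply_eq.2 ghost_lamOne.symm] at h

end Lambda

/-! ### Laws and moments -/

theorem law_moment {A : Type*} [Ring A] [Algebra ℂ A] (φ : A →ₗ[ℂ] ℂ) (hφ : φ 1 = 1) (a : A)
    (n : ℕ) : (law φ hφ a).moment n = φ (a ^ n) := by
  simp [law, Law.moment]

theorem Law.ext_moment {μ ν : Law} (h : ∀ n, μ.moment n = ν.moment n) : μ = ν :=
  Subtype.ext (Polynomial.lhom_ext' fun n => LinearMap.ext_ring (by
    simpa [Law.moment, Polynomial.X_pow_eq_monomial] using h n))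

/-! ### The joint distribution of a free pair is determined -/

section Joint

open Polynomial

/-- The noncommutative polynomial `p₁(x_{i₁}) ⋯ pₙ(x_{iₙ})`. -/
noncomputable def wordProd (l : List (Bool × ℂ[X])) : FreeAlgebra ℂ Bool :=
  (l.map fun x => aeval (FreeAlgebra.ι ℂ x.1) x.2).prod

/-- The alternating words `p₁(x_{i₁}) ⋯ pₙ(x_{iₙ})` in centred polynomials. -/
def IsCentredWord (m : Bool → ℂ[X] →ₗ[ℂ] ℂ) (l : List (Bool × ℂ[X])) : Prop :=
  l.IsChain (fun x y => x.1 ≠ y.1) ∧ ∀ x ∈ l, m x.1 x.2 = 0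

/-- Split `p` into its centred part, which extends the word, and its mean, which leaves the word
unchanged. -/
theorem aeval_mul_wordProd_mem (m : Bool → ℂ[X] →ₗ[ℂ] ℂ) (hm : ∀ i, m i 1 = 1) (i : Bool)
    (p : ℂ[X]) (l : List (Bool × ℂ[X])) (hl : IsCentredWord m l)
    (hi : ∀ y ∈ l.head?, i ≠ y.1) :
    aeval (FreeAlgebra.ι ℂ i) p * wordProd l ∈
      Submodule.span ℂ (wordProd '' {l | IsCentredWord m l}) := by
  have h : aeval (FreeAlgebra.ι ℂ i) p * wordProd l =
      wordProd ((i, p - C (m i p)) :: l) + m i p • wordProd l := by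
    simp only [wordProd, List.map_cons, List.prod_cons, map_sub, aeval_C, sub_mul]
    rw [Algebra.smul_def, sub_add_cancel]
  rw [h]
  refine add_mem (Submodule.subset_span ⟨_, ⟨?_, ?_⟩, rfl⟩)
    (Submodule.smul_mem _ _ (Submodule.subset_span ⟨_, hl, rfl⟩))
  · exact List.isChain_cons.2 ⟨hi, hl.1⟩
  · rintro x hx
    rcases List.mem_cons.1 hx with rfl | hx
    · have : C (m i p) = m i p • (1 : ℂ[X]) := by rw [Polynomial.smul_eq_C_mul, mul_one]
      simp [this, hm]
    · exact hl.2 x hx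

theorem span_wordProd_eq_top (m : Bool → ℂ[X] →ₗ[ℂ] ℂ) (hm : ∀ i, m i 1 = 1) :
    Submodule.span ℂ (wordProd '' {l | IsCentredWord m l}) = ⊤ := by
  set V := Submodule.span ℂ (wordProd '' {l | IsCentredWord m l}) with hV
  have hgen : ∀ i, ∀ v ∈ V, FreeAlgebra.ι ℂ i * v ∈ V := by
    intro i v hv
    induction hv using Submodule.span_induction with
    | mem v hv =>
      obtain ⟨l, hl, rfl⟩ := hv
      by_cases hi : ∀ y ∈ l.head?, i ≠ y.1
      · simpa using aeval_mul_wordProd_mem m hm i X l hl hi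
      · rcases l with _ | ⟨⟨j, p⟩, l⟩
        · simp at hi
        · obtain rfl : i = j := by simpa using hi
          -- The word already starts with the letter `i`: absorb the generator into its first
          -- polynomial, which need no longer be centred, and apply the lemma to the tail.
          have h := aeval_mul_wordProd_mem m hm i (X * p) l
            ⟨hl.1.tail, fun x hx => hl.2 x (List.mem_cons_of_mem _ hx)⟩
            (List.isChain_cons.1 hl.1).1
          simpa [wordProd, mul_assoc] using h
    | zero => simp
    | add x y _ _ hx hy => rw [mul_add]; exact add_mem hx hy
    | smul c x _ hx => rw [mul_smul_comm]; exact V.smul_mem c hx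
  have hone : (1 : FreeAlgebra ℂ Bool) ∈ V :=
    Submodule.subset_span ⟨[], ⟨by simp, by simp⟩, by simp [wordProd]⟩
  have hall : ∀ x : FreeAlgebra ℂ Bool, ∀ v ∈ V, x * v ∈ V := by
    intro x
    induction x using FreeAlgebra.induction with
    | grade0 r => intro v hv; rw [← Algebra.smul_def]; exact V.smul_mem r hv
    | grade1 i => exact hgen i
    | mul a b ha hb => intro v hv; rw [mul_assoc]; exact ha _ (hb v hv)
    | add a b ha hb => intro v hv; rw [add_mul]; exact add_mem (ha v hv) (hb v hv)
  exact eq_top_iff.2 fun x _ => by simpa using hall x 1 hone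

theorem FreePair.apply_lift_wordProd {A : Type*} [Ring A] [Algebra ℂ A] {φ : A →ₗ[ℂ] ℂ}
    (hφ : φ 1 = 1) {a b : A} (h : FreePair φ a b) {l : List (Bool × ℂ[X])}
    (hl : IsCentredWord (fun i => φ ∘ₗ (aeval (cond i a b)).toLinearMap) l) :
    φ (FreeAlgebra.lift ℂ (fun i => cond i a b) (wordProd l)) = if l = [] then 1 else 0 := by
  split_ifs with h0
  · simp [h0, wordProd, hφ]
  · let f : Bool × ℂ[X] → Σ i : Bool, Algebra.adjoin ℂ {cond i a b} := fun x =>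
      ⟨x.1, ⟨aeval (cond x.1 a b) x.2, aeval_mem_adjoin_singleton ℂ _⟩⟩
    have h1 := h (l.map f) (by simpa using h0) (List.isChain_map f |>.2 hl.1) (by
      intro x hx
      obtain ⟨y, hy, rfl⟩ := List.mem_map.1 hx
      exact hl.2 y hy)
    have h2 : FreeAlgebra.lift ℂ (fun i => cond i a b) ∘
        (fun x : Bool × ℂ[X] => aeval (FreeAlgebra.ι ℂ x.1) x.2) = (fun x => (x.2 : A)) ∘ f := by
      funext x
      simp [f, ← aeval_algHom_apply]
    rwa [List.map_map, ← h2, ← List.map_map, ← map_list_prod] at h1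

/-- Which words are centred depends only on the two marginals, and on such words both states take
the same value, `1` or `0`. These words span. -/
theorem FreePair.apply_lift_eq {A A' : Type*} [Ring A] [Algebra ℂ A] [Ring A'] [Algebra ℂ A']
    {φ : A →ₗ[ℂ] ℂ} (hφ : φ 1 = 1) {a b : A} (h : FreePair φ a b)
    {φ' : A' →ₗ[ℂ] ℂ} (hφ' : φ' 1 = 1) {a' b' : A'} (h' : FreePair φ' a' b')
    (ha : law φ hφ a = law φ' hφ' a') (hb : law φ hφ b = law φ' hφ' b')
    (w : FreeAlgebra ℂ Bool) :
    φ (FreeAlgebra.lift ℂ (fun i => cond i a b) w) =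
      φ' (FreeAlgebra.lift ℂ (fun i => cond i a' b') w) := by
  have hm : (fun i : Bool => φ ∘ₗ (aeval (cond i a b)).toLinearMap) =
      fun i : Bool => φ' ∘ₗ (aeval (cond i a' b')).toLinearMap := by
    funext i
    cases i
    · exact congrArg Subtype.val hb
    · exact congrArg Subtype.val ha
  have hw : w ∈ Submodule.span ℂ (wordProd ''
      {l | IsCentredWord (fun i => φ ∘ₗ (aeval (cond i a b)).toLinearMap) l}) := by
    rw [span_wordProd_eq_top _ (by simp [hφ])]
    trivial
  induction hw using Submodule.span_induction with
  | mem v hv =>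
    obtain ⟨l, hl, rfl⟩ := hv
    rw [h.apply_lift_wordProd hφ hl, h'.apply_lift_wordProd hφ' (hm ▸ hl)]
  | zero => simp
  | add x y _ _ hx hy => simp [hx, hy]
  | smul c x _ hx => simp [hx]

theorem FreePair.law_lift_eq {A A' : Type*} [Ring A] [Algebra ℂ A] [Ring A'] [Algebra ℂ A']
    {φ : A →ₗ[ℂ] ℂ} (hφ : φ 1 = 1) {a b : A} (h : FreePair φ a b)
    {φ' : A' →ₗ[ℂ] ℂ} (hφ' : φ' 1 = 1) {a' b' : A'} (h' : FreePair φ' a' b')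
    (ha : law φ hφ a = law φ' hφ' a') (hb : law φ hφ b = law φ' hφ' b')
    (w : FreeAlgebra ℂ Bool) :
    law φ hφ (FreeAlgebra.lift ℂ (fun i => cond i a b) w) =
      law φ' hφ' (FreeAlgebra.lift ℂ (fun i => cond i a' b') w) :=
  Law.ext_moment fun n => by
    simpa only [law_moment, map_pow] using h.apply_lift_eq hφ hφ' h' ha hb (w ^ n)

theorem FreePair.law_add_eq {A A' : Type*} [Ring A] [Algebra ℂ A] [Ring A'] [Algebra ℂ A']
    {φ : A →ₗ[ℂ] ℂ} (hφ : φ 1 = 1) {a b : A} (h : FreePair φ a b)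
    {φ' : A' →ₗ[ℂ] ℂ} (hφ' : φ' 1 = 1) {a' b' : A'} (h' : FreePair φ' a' b')
    (ha : law φ hφ a = law φ' hφ' a') (hb : law φ hφ b = law φ' hφ' b') :
    law φ hφ (a + b) = law φ' hφ' (a' + b') := by
  simpa using h.law_lift_eq hφ hφ' h' ha hb (FreeAlgebra.ι ℂ true + FreeAlgebra.ι ℂ false)

theorem FreePair.law_mul_eq {A A' : Type*} [Ring A] [Algebra ℂ A] [Ring A'] [Algebra ℂ A']
    {φ : A →ₗ[ℂ] ℂ} (hφ : φ 1 = 1) {a b : A} (h : FreePair φ a b)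
    {φ' : A' →ₗ[ℂ] ℂ} (hφ' : φ' 1 = 1) {a' b' : A'} (h' : FreePair φ' a' b')
    (ha : law φ hφ a = law φ' hφ' a') (hb : law φ hφ b = law φ' hφ' b') :
    law φ hφ (a * b) = law φ' hφ' (a' * b') := by
  simpa using h.law_lift_eq hφ hφ' h' ha hb (FreeAlgebra.ι ℂ true * FreeAlgebra.ι ℂ false)

theorem FreePair.law_add_eq_boxplus {A : Type*} [Ring A] [Algebra ℂ A] {φ : A →ₗ[ℂ] ℂ}
    (hφ : φ 1 = 1) {a b : A} (h : FreePair φ a b)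
    (hex : ∃ ρ, IsFreeAddConv (law φ hφ a) (law φ hφ b) ρ) :
    law φ hφ (a + b) = boxplus (law φ hφ a) (law φ hφ b) := by
  obtain ⟨A', _, _, φ', hφ', a', b', h', ha, hb, hab⟩ := Classical.epsilon_spec hex
  exact (h.law_add_eq hφ hφ' h' ha.symm hb.symm).trans hab

theorem FreePair.law_mul_eq_boxtimes {A : Type*} [Ring A] [Algebra ℂ A] {φ : A →ₗ[ℂ] ℂ}
    (hφ : φ 1 = 1) {a b : A} (h : FreePair φ a b)
    (hex : ∃ ρ, IsFreeMulConv (law φ hφ a) (law φ hφ b) ρ) :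
    law φ hφ (a * b) = boxtimes (law φ hφ a) (law φ hφ b) := by
  obtain ⟨A', _, _, φ', hφ', a', b', h', ha, hb, hab⟩ := Classical.epsilon_spec hex
  exact (h.law_mul_eq hφ hφ' h' ha.symm hb.symm).trans hab

end Joint

/-! ### Power series in a locally nilpotent operator -/

section LocallyNilpotent

variable {M N : Type*} [AddCommGroup M] [Module ℂ M] [AddCommGroup N] [Module ℂ N]

theorem pow_apply_eq_zero_of_le {L : Module.End ℂ M} {v : M} {n k : ℕ} (h : (L ^ n) v = 0)
    (hk : n ≤ k) : (L ^ k) v = 0 := by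
  rw [← Nat.sub_add_cancel hk, pow_add, Module.End.mul_apply, h, map_zero]

theorem finsum_coeff_smul_pow_apply (f : PowerSeries ℂ) {L : Module.End ℂ M} {v : M} {n : ℕ}
    (h : (L ^ n) v = 0) :
    ∑ᶠ k, PowerSeries.coeff k f • (L ^ k) v =
      ∑ k ∈ Finset.range n, PowerSeries.coeff k f • (L ^ k) v := by
  refine finsum_eq_sum_of_support_subset _ fun k hk => ?_
  by_contra hkn
  apply hk
  beta_reduce
  rw [pow_apply_eq_zero_of_le h (by simpa using hkn), smul_zero]

/-- The operator `f(L) = ∑ fₖ Lᵏ` for a power series `f` and a locally nilpotent operator `L`. -/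
noncomputable def seriesEnd (f : PowerSeries ℂ) (L : Module.End ℂ M)
    (hL : ∀ v, ∃ n, (L ^ n) v = 0) : Module.End ℂ M where
  toFun v := ∑ᶠ k, PowerSeries.coeff k f • (L ^ k) v
  map_add' v w := by
    obtain ⟨m, hm⟩ := hL v
    obtain ⟨n, hn⟩ := hL w
    have hm' := pow_apply_eq_zero_of_le hm (le_max_left m n)
    have hn' := pow_apply_eq_zero_of_le hn (le_max_right m n)
    rw [finsum_coeff_smul_pow_apply f hm', finsum_coeff_smul_pow_apply f hn',
      finsum_coeff_smul_pow_apply (v := v + w) f (by rw [map_add, hm', hn', add_zero]),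
      ← Finset.sum_add_distrib]
    simp
  map_smul' c v := by
    obtain ⟨m, hm⟩ := hL v
    rw [finsum_coeff_smul_pow_apply f hm,
      finsum_coeff_smul_pow_apply (v := c • v) f (by rw [map_smul, hm, smul_zero]),
      RingHom.id_apply, Finset.smul_sum]
    simp [smul_comm c]

theorem seriesEnd_apply (f : PowerSeries ℂ) {L : Module.End ℂ M} (hL : ∀ v, ∃ n, (L ^ n) v = 0)
    {v : M} {n : ℕ} (h : (L ^ n) v = 0) :
    seriesEnd f L hL v = ∑ k ∈ Finset.range n, PowerSeries.coeff k f • (L ^ k) v :=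
  finsum_coeff_smul_pow_apply f h

theorem seriesEnd_intertwine (f : PowerSeries ℂ) {L : Module.End ℂ M} {L' : Module.End ℂ N}
    (hL : ∀ v, ∃ n, (L ^ n) v = 0) (hL' : ∀ v, ∃ n, (L' ^ n) v = 0) (J : M →ₗ[ℂ] N)
    (hJ : ∀ v, J (L v) = L' (J v)) (v : M) :
    J (seriesEnd f L hL v) = seriesEnd f L' hL' (J v) := by
  have hJn : ∀ n v, J ((L ^ n) v) = (L' ^ n) (J v) := by
    intro n
    induction n with
    | zero => simp
    | succ n ih => intro v; rw [pow_succ, pow_succ, Module.End.mul_apply, ih, hJ]; rfl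
  obtain ⟨n, hn⟩ := hL v
  rw [seriesEnd_apply f hL hn, seriesEnd_apply f hL' (n := n) (by rw [← hJn, hn, map_zero])]
  simp [hJn]

/-- The generating series `∑ θ(wₙ) zⁿ`. -/
noncomputable def genSeries (θ : M →ₗ[ℂ] ℂ) (w : ℕ → M) : PowerSeries ℂ :=
  PowerSeries.mk fun n => θ (w n)

/-- The formal vector `∑ wₙ zⁿ` is an eigenvector of `L` with eigenvalue `z`, so `f(L)` acts on it
as `f(z)`. Testing against functionals `θ` keeps all series scalar. -/
theorem genSeries_comp_seriesEnd (f : PowerSeries ℂ) {L : Module.End ℂ M}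
    (hL : ∀ v, ∃ n, (L ^ n) v = 0) {w : ℕ → M} (h0 : L (w 0) = 0)
    (hw : ∀ n, L (w (n + 1)) = w n) (θ : M →ₗ[ℂ] ℂ) :
    genSeries (θ ∘ₗ seriesEnd f L hL) w = f * genSeries θ w := by
  have hpow : ∀ k m, (L ^ k) (w (m + k)) = w m := by
    intro k
    induction k with
    | zero => simp
    | succ k ih =>
      intro m
      rw [pow_succ, Module.End.mul_apply, ← add_assoc, hw, ih]
  ext n
  have hz : (L ^ (n + 1)) (w n) = 0 := by
    have h1 := hpow n 0
    rw [zero_add] at h1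
    rw [pow_succ', Module.End.mul_apply, h1, h0]
  rw [PowerSeries.coeff_mul, Finset.Nat.sum_antidiagonal_eq_sum_range_succ_mk]
  simp only [genSeries, PowerSeries.coeff_mk, LinearMap.comp_apply]
  rw [seriesEnd_apply f hL hz, map_sum]
  refine Finset.sum_congr rfl fun k hk => ?_
  have h2 := hpow k (n - k)
  rw [Nat.sub_add_cancel (by have := Finset.mem_range.1 hk; omega)] at h2
  rw [h2, map_smul, smul_eq_mul]

theorem genSeries_add (θ θ' : M →ₗ[ℂ] ℂ) (w : ℕ → M) :
    genSeries (θ + θ') w = genSeries θ w + genSeries θ' w := by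
  ext; simp [genSeries]

theorem X_mul_genSeries_comp_orbit (K : Module.End ℂ M) (v : M) (θ : M →ₗ[ℂ] ℂ) :
    PowerSeries.X * genSeries (θ ∘ₗ K) (fun n => (K ^ n) v) =
      genSeries θ (fun n => (K ^ n) v) - PowerSeries.C (θ v) := by
  ext n
  rcases n with _ | n
  · simp [genSeries]
  · simp [genSeries, PowerSeries.coeff_succ_X_mul, pow_succ']

end LocallyNilpotent

/-! ### The full Fock space over two letters -/

/-- The algebraic full Fock space of `ℂ²`. -/
abbrev Fock : Type := List Bool →₀ ℂ

/-- The left creation operators. -/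
noncomputable def cre (i : Bool) : Module.End ℂ Fock := Finsupp.lmapDomain ℂ ℂ (List.cons i)

/-- The left annihilation operators. -/
noncomputable def ann (i : Bool) : Module.End ℂ Fock :=
  Finsupp.lcomapDomain (List.cons i) List.cons_injective

/-- The vacuum vector. -/
noncomputable def vac : Fock := Finsupp.single [] 1

/-- The coefficient of the vacuum vector. -/
noncomputable def vacCoeff : Fock →ₗ[ℂ] ℂ := Finsupp.lapply []

/-- The vacuum state. -/
noncomputable def vacState : Module.End ℂ Fock →ₗ[ℂ] ℂ := vacCoeff ∘ₗ LinearMap.applyₗ vac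

theorem vacState_apply (T : Module.End ℂ Fock) : vacState T = vacCoeff (T vac) := rfl

theorem vacCoeff_vac : vacCoeff vac = 1 := by simp [vacCoeff, vac]

theorem vacState_one : vacState 1 = 1 := vacCoeff_vac

theorem ann_apply (i : Bool) (x : Fock) (l : List Bool) : ann i x l = x (i :: l) := rfl

theorem ann_mul_cre_self (i : Bool) : ann i * cre i = 1 := by
  ext1 l
  ext : 2
  simp [cre, ann_apply, Finsupp.single_apply]

theorem ann_mul_cre_of_ne {i j : Bool} (h : i ≠ j) : ann i * cre j = 0 := by
  ext1 l
  ext : 2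
  simp [cre, ann_apply, h.symm]

theorem ann_vac (i : Bool) : ann i vac = 0 := by
  ext l
  simp [ann_apply, vac]

theorem vacCoeff_cre (i : Bool) (x : Fock) : vacCoeff (cre i x) = 0 := by
  have h : vacCoeff ∘ₗ cre i = 0 := by
    ext l
    simp [vacCoeff, cre]
  exact LinearMap.congr_fun h x

theorem ann_locally_nilpotent (i : Bool) (x : Fock) : ∃ n, (ann i ^ n) x = 0 := by
  -- Coefficients of `annⁿ x` are coefficients of `x` at words of length at least `n`, and `x` has
  -- finite support.
  have hpow : ∀ n l, ∃ l' : List Bool, l'.length = l.length + n ∧ (ann i ^ n) x l = x l' := by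
    intro n
    induction n with
    | zero => exact fun l => ⟨l, by simp⟩
    | succ n ih =>
      intro l
      obtain ⟨l', h, h'⟩ := ih (i :: l)
      refine ⟨l', by rw [h, List.length_cons]; omega, ?_⟩
      rw [pow_succ', Module.End.mul_apply, ann_apply, h']
  refine ⟨x.support.sup List.length + 1, ?_⟩
  ext l
  obtain ⟨l', h, h'⟩ := hpow (x.support.sup List.length + 1) l
  rw [h', Finsupp.zero_apply]
  by_contra hx
  have := Finset.le_sup (f := List.length) (Finsupp.mem_support_iff.2 hx)
  omega

/-- A power series in an annihilation operator. -/
noncomputable def annSeries (i : Bool) (f : PowerSeries ℂ) : Module.End ℂ Fock :=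
  seriesEnd f (ann i) (ann_locally_nilpotent i)

/-! ### Freeness in the Fock space -/

section Freeness

open Polynomial

/-- The algebra of operators acting on the left tensor factor `ℂ[cre i]` of the decomposition
of the Fock space into `ℂ[cre i] ⊗ ker (ann i)`. -/
noncomputable def leftAlg (i : Bool) : Subalgebra ℂ (Module.End ℂ Fock) where
  carrier := {T | ∃ T₀ : Module.End ℂ ℂ[X], ∀ x, ann i x = 0 → ∀ p : ℂ[X],
    T (aeval (cre i) p x) = aeval (cre i) (T₀ p) x}
  mul_mem' := by
    rintro S T ⟨S₀, hS⟩ ⟨T₀, hT⟩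
    exact ⟨S₀ * T₀, fun x hx p => by simp [hT x hx, hS x hx]⟩
  add_mem' := by
    rintro S T ⟨S₀, hS⟩ ⟨T₀, hT⟩
    exact ⟨S₀ + T₀, fun x hx p => by simp [hT x hx, hS x hx]⟩
  algebraMap_mem' r := ⟨algebraMap ℂ _ r, fun x hx p => by
    simp [Module.algebraMap_end_apply]⟩

theorem cre_mem_leftAlg (i : Bool) : cre i ∈ leftAlg i :=
  ⟨LinearMap.mulLeft ℂ X, fun x _ p => by simp⟩

/-- On `p(cre i) x` with `ann i x = 0`, annihilation acts as the backward shift `p ↦ (p - p(0)) /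
X`. The shift is locally nilpotent too, so the intertwining passes to power series. -/
theorem annSeries_mem_leftAlg (i : Bool) (f : PowerSeries ℂ) : annSeries i f ∈ leftAlg i := by
  let D : Module.End ℂ ℂ[X] :=
    { toFun := Polynomial.divX
      map_add' := fun p q => divX_add
      map_smul' := fun c p => by simp [smul_eq_C_mul, divX_C_mul] }
  have hD : ∀ p : ℂ[X], ∃ n, (D ^ n) p = 0 := by
    have hpow : ∀ n (p : ℂ[X]) m, ((D ^ n) p).coeff m = p.coeff (m + n) := by
      intro n
      induction n with
      | zero => simp
      | succ n ih =>
        intro p m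
        rw [pow_succ, Module.End.mul_apply, ih]
        exact (coeff_divX ..).trans (congrArg p.coeff (by omega))
    refine fun p => ⟨p.natDegree + 1, ?_⟩
    ext m
    rw [hpow, coeff_eq_zero_of_natDegree_lt (by omega), coeff_zero]
  refine ⟨seriesEnd f D hD, fun x hx p => Eq.symm ?_⟩
  refine seriesEnd_intertwine f hD (ann_locally_nilpotent i)
    (LinearMap.applyₗ x ∘ₗ (aeval (cre i)).toLinearMap) (fun q => ?_) p
  change aeval (cre i) (Polynomial.divX q) x = ann i (aeval (cre i) q x)
  conv_rhs => rw [← X_mul_divX_add q]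
  rw [map_add, map_mul, aeval_X, aeval_C, LinearMap.add_apply, map_add, Module.End.mul_apply,
    ← Module.End.mul_apply, ann_mul_cre_self, Module.algebraMap_end_apply, map_smul, hx]
  simp

/-- On `ker (ann i)`, `T` acts as the polynomial `T₀ 1` in `cre i`, whose constant term is the
vacuum expectation of `T`. -/
theorem apply_mem_range_cre {i : Bool} {T : Module.End ℂ Fock} (hT : T ∈ leftAlg i)
    (h0 : vacState T = 0) {x : Fock} (hx : ann i x = 0) : ∃ y, T x = cre i y := by
  obtain ⟨T₀, h⟩ := hT
  have key : ∀ x, ann i x = 0 →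
      T x = cre i (aeval (cre i) (Polynomial.divX (T₀ 1)) x) + (T₀ 1).coeff 0 • x := by
    intro x hx
    have h1 := h x hx 1
    rw [map_one, Module.End.one_apply] at h1
    rw [h1]
    conv_lhs => rw [← X_mul_divX_add (T₀ 1)]
    rw [map_add, map_mul, aeval_X, aeval_C, LinearMap.add_apply, Module.End.mul_apply,
      Module.algebraMap_end_apply]
  have hc : (T₀ 1).coeff 0 = 0 := by
    rw [vacState_apply, key vac (ann_vac i), map_add, vacCoeff_cre, map_smul, vacCoeff_vac] at h0
    simpa using h0
  exact ⟨_, by rw [key x hx, hc, zero_smul, add_zero]⟩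

/-- A centred factor sends `ker (ann i)` into the range of `cre i`, which lies in `ker (ann j)` for
`j ≠ i`. So an alternating product sends the vacuum into the range of a creation operator, where the
vacuum coefficient vanishes. -/
theorem areFree_of_le_leftAlg {B : Bool → Subalgebra ℂ (Module.End ℂ Fock)}
    (hB : ∀ i, B i ≤ leftAlg i) : AreFree (A := Module.End ℂ Fock) vacState B := by
  intro l
  have key : ∀ (l : List (Σ i, B i)) (x : Σ i, B i),
      (x :: l).IsChain (fun x y => x.1 ≠ y.1) →
      (∀ y ∈ x :: l, vacState (y.2 : Module.End ℂ Fock) = 0) →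
      ∃ y, ((x :: l).map fun x => (x.2 : Module.End ℂ Fock)).prod vac = cre x.1 y := by
    intro l
    induction l with
    | nil =>
      intro x _ h
      simpa using apply_mem_range_cre (hB _ x.2.2) (h x (by simp)) (ann_vac x.1)
    | cons y l ih =>
      intro x hc h
      obtain ⟨z, hz⟩ := ih y hc.tail fun t ht => h t (List.mem_cons_of_mem _ ht)
      rw [List.map_cons, List.prod_cons, Module.End.mul_apply, hz]
      refine apply_mem_range_cre (hB _ x.2.2) (h x (by simp)) ?_
      rw [← Module.End.mul_apply, ann_mul_cre_of_ne (List.isChain_cons_cons.1 hc).1]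
      rfl
  rcases l with _ | ⟨x, l⟩
  · simp
  · intro _ hc h
    obtain ⟨y, hy⟩ := key l x hc h
    rw [vacState_apply, hy, vacCoeff_cre]

theorem freePair_of_mem_leftAlg {a b : Module.End ℂ Fock} (ha : a ∈ leftAlg true)
    (hb : b ∈ leftAlg false) : FreePair vacState a b := by
  refine areFree_of_le_leftAlg fun i => Algebra.adjoin_le ?_
  cases i <;> simpa

end Freeness

section Transforms

open PowerSeries

/-! ### The transforms as compositional inverses -/

theorem C_add_X_mul_divX (f : PowerSeries ℂ) : C (coeff 0 f) + X * divX f = f := by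
  ext n
  rcases n with _ | n
  · simp
  · simp [divX, coeff_succ_X_mul]

theorem X_mul_divX {f : PowerSeries ℂ} (h : constantCoeff f = 0) : X * divX f = f := by
  conv_rhs => rw [← C_add_X_mul_divX f]
  simp [h]

theorem divX_X_mul (f : PowerSeries ℂ) : divX (X * f) = f := by
  ext n
  simp [divX, coeff_succ_X_mul]

theorem subst_eq_C_add {u : PowerSeries ℂ} (hu : constantCoeff u = 0) (f : PowerSeries ℂ) :
    f.subst u = C (coeff 0 f) + u * (divX f).subst u := by
  have hs : HasSubst u := HasSubst.of_constantCoeff_zero' hu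
  conv_lhs => rw [← C_add_X_mul_divX f]
  rw [subst_add hs, subst_mul hs, subst_X hs, subst_C]
  rfl

/-- A left and a right compositional inverse coincide. -/
theorem substInvOfIsUnit_eq {P u : PowerSeries ℂ} (hP : constantCoeff P = 0)
    (hP' : IsUnit (coeff 1 P)) (hu : constantCoeff u = 0) (h : P.subst u = X) :
    P.substInvOfIsUnit hP' = u := by
  have hs : HasSubst u := HasSubst.of_constantCoeff_zero' hu
  have hsP : HasSubst P := HasSubst.of_constantCoeff_zero' hP
  have h1 := subst_comp_subst_apply hsP hs (P.substInvOfIsUnit hP')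
  rwa [subst_substInvOfIsUnit_left P hP, h, X_subst, subst_X hs, eq_comm] at h1

theorem eq_of_substInvOfIsUnit_eq {P Q : PowerSeries ℂ} (hP : constantCoeff P = 0)
    (hQ : constantCoeff Q = 0) (hP' : IsUnit (coeff 1 P)) (hQ' : IsUnit (coeff 1 Q))
    (h : P.substInvOfIsUnit hP' = Q.substInvOfIsUnit hQ') : P = Q := by
  have hsQ : HasSubst Q := HasSubst.of_constantCoeff_zero' hQ
  have hs : HasSubst (P.substInvOfIsUnit hP') := HasSubst.substInvOfIsUnit _ _
  have h1 := subst_comp_subst_apply hs hsQ P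
  rwa [subst_substInvOfIsUnit_right P hP, h, subst_substInvOfIsUnit_left Q hQ, X_subst,
    subst_X hsQ, eq_comm] at h1

theorem inv_inv_of_constantCoeff_ne_zero {f : PowerSeries ℂ} (h : constantCoeff f ≠ 0) :
    f⁻¹⁻¹ = f :=
  ((PowerSeries.eq_inv_iff_mul_eq_one (by simpa using h)).2 (PowerSeries.mul_inv_cancel f h)).symm

theorem momentSeries_injective : Function.Injective momentSeries := fun μ ν h =>
  Law.ext_moment fun n => by simpa [momentSeries] using congrArg (coeff n) h

theorem constantCoeff_momentSeries (μ : Law) : constantCoeff (momentSeries μ) = 1 := by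
  rw [← coeff_zero_eq_constantCoeff_apply, momentSeries, coeff_mk, moment_zero]

theorem constantCoeff_psi (μ : Law) : constantCoeff (psi μ) = 0 := by
  simp [psi, constantCoeff_momentSeries]

theorem constantCoeff_X_mul_inv (h : PowerSeries ℂ) : constantCoeff (X * h⁻¹) = 0 := by simp

theorem RTransform_eq_of_subst {μ : Law} {f : PowerSeries ℂ}
    (H : (momentSeries μ).subst (X * (1 + X * f)⁻¹) = 1 + X * f) : RTransform μ = f := by
  have h0 : constantCoeff (1 + X * f) ≠ 0 := by simp
  have hs : HasSubst (X * (1 + X * f)⁻¹) :=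
    HasSubst.of_constantCoeff_zero' (constantCoeff_X_mul_inv _)
  have h1 : (X * momentSeries μ).subst (X * (1 + X * f)⁻¹) = X := by
    rw [subst_mul hs, subst_X hs, H, mul_assoc, PowerSeries.inv_mul_cancel _ h0, mul_one]
  rw [RTransform, substInvOfIsUnit_eq (by simp) _ (constantCoeff_X_mul_inv _) h1, divX_X_mul,
    inv_inv_of_constantCoeff_ne_zero h0]
  ext n
  simp [divX, coeff_succ_X_mul, coeff_one]

theorem RTransform_injective : Function.Injective RTransform := by
  intro μ ν h
  have hc : ∀ μ : Law, constantCoeff (divX ((X * momentSeries μ).substInvOfIsUnit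
      (isUnit_coeff_one_cauchy μ))) = 1 := by
    intro μ
    simp [divX, constantCoeff_momentSeries]
  have hinv : ∀ μ : Law, (divX ((X * momentSeries μ).substInvOfIsUnit
      (isUnit_coeff_one_cauchy μ)))⁻¹ = 1 + X * RTransform μ := by
    intro μ
    conv_lhs => rw [← C_add_X_mul_divX (divX _)⁻¹]
    rw [RTransform, coeff_zero_eq_constantCoeff_apply, constantCoeff_inv, hc]
    simp
  have h1 := hinv μ
  rw [h, ← hinv ν] at h1
  have h2 := congrArg (·⁻¹) h1
  beta_reduce at h2
  rw [inv_inv_of_constantCoeff_ne_zero (by simp [hc]),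
    inv_inv_of_constantCoeff_ne_zero (by simp [hc])] at h2
  have h3 := congrArg (X * ·) h2
  beta_reduce at h3
  rw [X_mul_divX (by simp), X_mul_divX (by simp)] at h3
  have h4 := eq_of_substInvOfIsUnit_eq (by simp) (by simp) _ _ h3
  exact momentSeries_injective (mul_left_cancel₀ X_ne_zero h4)

theorem STransform_injective : Function.Injective STransform := by
  intro μ ν h
  have h1 := congrArg Subtype.val h
  simp only [STransform] at h1
  have h0 : (1 + X : PowerSeries ℂ) ≠ 0 := by
    intro h
    simpa using congrArg constantCoeff h
  have h3 := congrArg (X * ·) (mul_left_cancel₀ h0 h1)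
  beta_reduce at h3
  rw [X_mul_divX (by simp), X_mul_divX (by simp)] at h3
  have h4 := eq_of_substInvOfIsUnit_eq (constantCoeff_psi _) (constantCoeff_psi _) _ _ h3
  exact Subtype.ext (momentSeries_injective (sub_left_injective h4))

theorem psi_subst {μ : Law} {f : PowerSeries ℂ} (hf : constantCoeff f = 1)
    (H : (momentSeries μ).subst (X * (f * (1 + X))⁻¹) * f = f * (1 + X)) :
    (psi μ).subst (X * (f * (1 + X))⁻¹) = X := by
  have hs : HasSubst (X * (f * (1 + X))⁻¹) :=
    HasSubst.of_constantCoeff_zero' (constantCoeff_X_mul_inv _)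
  have hf0 : f ≠ 0 := by rintro rfl; simp at hf
  rw [mul_comm] at H
  rw [psi, subst_sub hs, mul_left_cancel₀ hf0 H, ← coe_substAlgHom hs, map_one,
    add_sub_cancel_left]

theorem moment_one_eq_one {μ : Law} {f : PowerSeries ℂ} (hf : constantCoeff f = 1)
    (H : (momentSeries μ).subst (X * (f * (1 + X))⁻¹) * f = f * (1 + X)) :
    μ.moment 1 = 1 := by
  have h := psi_subst hf H
  have hu : constantCoeff (X * (f * (1 + X))⁻¹) = 0 := constantCoeff_X_mul_inv _
  rw [subst_eq_C_add hu, coeff_zero_eq_constantCoeff_apply, constantCoeff_psi, map_zero, zero_add,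
    subst_eq_C_add hu] at h
  -- The substituted series is `z + ⋯` since `f` has constant term `1`; the coefficient of `z` in
  -- `ψ(z + ⋯) = z` is therefore `m₁`.
  have h1 := congrArg (coeff 1) h
  simpa [mul_assoc, hf, divX, psi, momentSeries, coeff_one] using h1

theorem STransform_eq_of_subst {μ : MeanOneLaw} {f : PowerSeries ℂ} (hf : constantCoeff f = 1)
    (H : (momentSeries μ.1).subst (X * (f * (1 + X))⁻¹) * f = f * (1 + X)) :
    (STransform μ).1 = f⁻¹ := by
  change (1 + X) * divX ((psi μ.1).substInvOfIsUnit (isUnit_coeff_one_psi μ)) = f⁻¹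
  rw [substInvOfIsUnit_eq (constantCoeff_psi _) _ (constantCoeff_X_mul_inv _)
    (psi_subst hf H), divX_X_mul, PowerSeries.mul_inv_rev, ← mul_assoc,
    PowerSeries.mul_inv_cancel _ (by simp), one_mul]

/-- A recursion that determines the moment series. -/
theorem subst_mk_mul_eq (h d : PowerSeries ℂ) (hh : constantCoeff h ≠ 0) (m : ℕ → ℂ)
    (F : ℕ → PowerSeries ℂ) (h0 : F 0 = 1)
    (hF : ∀ k, X * F (k + 1) = h * F k - C (m k) * d) :
    (PowerSeries.mk m).subst (X * h⁻¹) * d = h := by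
  set v := X * h⁻¹ with hv
  have hv0 : constantCoeff v = 0 := constantCoeff_X_mul_inv _
  have hhi : h * h⁻¹ = 1 := PowerSeries.mul_inv_cancel h hh
  -- Iterating the recursion suggests `F N = (∑ mₖ₊ₙ vᵏ) d / h` with `n = N`; `D N` is the defect.
  -- Since `D N = v D (N + 1)` and `X ∣ v`, `D 0` is divisible by every power of `X`.
  let D : ℕ → PowerSeries ℂ := fun N =>
    (PowerSeries.mk fun k => m (k + N)).subst v * (d * h⁻¹) - F N
  have hD : ∀ N, D N = v * D (N + 1) := by
    intro N
    have h1 : divX (PowerSeries.mk fun k => m (k + N)) =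
        PowerSeries.mk fun k => m (k + (N + 1)) := by
      ext k
      simp [divX, add_assoc, add_comm 1]
    simp only [D]
    rw [subst_eq_C_add hv0, h1, coeff_mk, zero_add]
    linear_combination h⁻¹ * hF N + F N * hhi + F (N + 1) * hv
  have hD' : ∀ N, D 0 = v ^ N * D N := by
    intro N
    induction N with
    | zero => simp
    | succ N ih => rw [pow_succ, mul_assoc, ← hD, ← ih]
  have hz : D 0 = 0 := by
    ext n
    have h1 : X ^ (n + 1) ∣ D 0 := by
      rw [hD' (n + 1), hv, mul_pow, mul_assoc]
      exact dvd_mul_right _ _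
    simpa using X_pow_dvd_iff.1 h1 n (by omega)
  simp only [D, h0, add_zero] at hz
  linear_combination h * hz - (PowerSeries.mk m).subst v * d * hhi

/-! ### Transforms of operators on the Fock space -/

/-- The distribution of an operator on the Fock space in the vacuum state. -/
noncomputable def fockLaw (T : Module.End ℂ Fock) : Law :=
  law (A := Module.End ℂ Fock) vacState vacState_one T

theorem fockLaw_moment (T : Module.End ℂ Fock) (n : ℕ) :
    (fockLaw T).moment n = vacCoeff ((T ^ n) vac) := by
  rw [fockLaw, law_moment]
  rfl

theorem FreePair.fockLaw_add {a b : Module.End ℂ Fock}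
    (h : FreePair (A := Module.End ℂ Fock) vacState a b)
    (hex : ∃ ρ, IsFreeAddConv (fockLaw a) (fockLaw b) ρ) :
    fockLaw (a + b) = boxplus (fockLaw a) (fockLaw b) :=
  h.law_add_eq_boxplus vacState_one hex

theorem FreePair.fockLaw_mul {a b : Module.End ℂ Fock}
    (h : FreePair (A := Module.End ℂ Fock) vacState a b)
    (hex : ∃ ρ, IsFreeMulConv (fockLaw a) (fockLaw b) ρ) :
    fockLaw (a * b) = boxtimes (fockLaw a) (fockLaw b) :=
  h.law_mul_eq_boxtimes vacState_one hex

theorem vacCoeff_orbit {K : Module.End ℂ Fock} (hK : ∀ x, vacCoeff (K x) = 0) :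
    genSeries vacCoeff (fun n => (K ^ n) vac) = 1 := by
  ext n
  rcases n with _ | n
  · simp [genSeries, vacCoeff_vac]
  · simp [genSeries, pow_succ', hK, coeff_one]

/-- The relation `z a ω = h ω - d vac`, tested against `vacCoeff ∘ aᵏ`, is the moment recursion;
`vacCoeff ω = 1` starts it. -/
theorem momentSeries_subst_of_genSeries {K a : Module.End ℂ Fock}
    (hK : ∀ x, vacCoeff (K x) = 0) {h d : PowerSeries ℂ} (hh : constantCoeff h ≠ 0)
    (hrel : ∀ θ : Fock →ₗ[ℂ] ℂ, X * genSeries (θ ∘ₗ a) (fun n => (K ^ n) vac) =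
      h * genSeries θ (fun n => (K ^ n) vac) - C (θ vac) * d) :
    (momentSeries (fockLaw a)).subst (X * h⁻¹) * d = h := by
  refine subst_mk_mul_eq h d hh _ (fun k => genSeries (vacCoeff ∘ₗ (a ^ k))
    (fun n => (K ^ n) vac)) (vacCoeff_orbit hK) fun k => ?_
  have h1 := hrel (vacCoeff ∘ₗ (a ^ k))
  rw [fockLaw_moment, pow_succ]
  exact h1

theorem RTransform_law_add {K T : Module.End ℂ Fock} (hK : ∀ x, vacCoeff (K x) = 0)
    {f : PowerSeries ℂ} (hT : ∀ θ : Fock →ₗ[ℂ] ℂ, genSeries (θ ∘ₗ T) (fun n => (K ^ n) vac) =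
      f * genSeries θ (fun n => (K ^ n) vac)) :
    RTransform (fockLaw (K + T)) = f := by
  refine RTransform_eq_of_subst ?_
  rw [← mul_one (subst _ _)]
  refine momentSeries_subst_of_genSeries hK (by simp) fun θ => ?_
  rw [LinearMap.comp_add, genSeries_add, mul_add, X_mul_genSeries_comp_orbit, hT]
  ring

theorem genSeries_comp_annSeries_orbit {K : Module.End ℂ Fock} {i : Bool}
    (hK : ann i * K = 1) (f : PowerSeries ℂ) (θ : Fock →ₗ[ℂ] ℂ) :
    genSeries (θ ∘ₗ annSeries i f) (fun n => (K ^ n) vac) =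
      f * genSeries θ (fun n => (K ^ n) vac) := by
  refine genSeries_comp_seriesEnd f (ann_locally_nilpotent i) (by simp [ann_vac]) (fun n => ?_) θ
  rw [pow_succ', Module.End.mul_apply, ← Module.End.mul_apply (ann i), hK, Module.End.one_apply]

/-- An operator whose vacuum distribution has `R`-transform `f`. -/
noncomputable def rModel (i : Bool) (f : PowerSeries ℂ) : Module.End ℂ Fock := cre i + annSeries i f

/-- An operator whose vacuum distribution has `S`-transform `1 / f`. -/
noncomputable def sModel (i : Bool) (f : PowerSeries ℂ) : Module.End ℂ Fock :=
  (1 + cre i) * annSeries i f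

theorem rModel_mem_leftAlg (i : Bool) (f : PowerSeries ℂ) : rModel i f ∈ leftAlg i :=
  add_mem (cre_mem_leftAlg i) (annSeries_mem_leftAlg i f)

theorem sModel_mem_leftAlg (i : Bool) (f : PowerSeries ℂ) : sModel i f ∈ leftAlg i :=
  mul_mem (add_mem (one_mem _) (cre_mem_leftAlg i)) (annSeries_mem_leftAlg i f)

theorem RTransform_law_rModel (i : Bool) (f : PowerSeries ℂ) :
    RTransform (fockLaw (rModel i f)) = f :=
  RTransform_law_add (vacCoeff_cre i)
    (genSeries_comp_annSeries_orbit (ann_mul_cre_self i) f)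

theorem RTransform_law_rModel_add (f g : PowerSeries ℂ) :
    RTransform (fockLaw (rModel true f + rModel false g)) = f + g := by
  have h : rModel true f + rModel false g =
      (cre true + cre false) + (annSeries true f + annSeries false g) := by
    simp only [rModel]; abel
  have ht : ann true * (cre true + cre false) = 1 := by
    rw [mul_add, ann_mul_cre_self, ann_mul_cre_of_ne (by simp), add_zero]
  have hf : ann false * (cre true + cre false) = 1 := by
    rw [mul_add, ann_mul_cre_self, ann_mul_cre_of_ne (by simp), zero_add]
  rw [h]
  refine RTransform_law_add (fun x => ?_) fun θ => ?_
  · rw [LinearMap.add_apply, map_add, vacCoeff_cre, vacCoeff_cre, add_zero]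
  · rw [LinearMap.comp_add, genSeries_add, genSeries_comp_annSeries_orbit ht,
      genSeries_comp_annSeries_orbit hf, add_mul]

/-- From `T ω = f (1 + K) ω` and `z K ω = ω - vac` follows `z T ω = f (1 + z) ω - f vac`. -/
theorem momentSeries_subst_of_genSeries_mul {K T : Module.End ℂ Fock}
    (hK : ∀ x, vacCoeff (K x) = 0) {f : PowerSeries ℂ} (hf : constantCoeff f = 1)
    (hT : ∀ θ : Fock →ₗ[ℂ] ℂ, genSeries (θ ∘ₗ T) (fun n => (K ^ n) vac) =
      f * genSeries (θ ∘ₗ (1 + K)) (fun n => (K ^ n) vac)) :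
    (momentSeries (fockLaw T)).subst (X * (f * (1 + X))⁻¹) * f =
      f * (1 + X) := by
  refine momentSeries_subst_of_genSeries hK (by simp [hf]) fun θ => ?_
  have h := X_mul_genSeries_comp_orbit K vac θ
  rw [hT, LinearMap.comp_add, genSeries_add, Module.End.one_eq_id, LinearMap.comp_id]
  linear_combination f * h

theorem momentSeries_subst_sModel (i : Bool) {f : PowerSeries ℂ} (hf : constantCoeff f = 1) :
    (momentSeries (fockLaw (sModel i f))).subst (X * (f * (1 + X))⁻¹) * f =
      f * (1 + X) :=
  momentSeries_subst_of_genSeries_mul (vacCoeff_cre i) hf fun θ =>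
    genSeries_comp_annSeries_orbit (ann_mul_cre_self i) f (θ ∘ₗ (1 + cre i))

theorem momentSeries_subst_sModel_mul {f g : PowerSeries ℂ} (hf : constantCoeff f = 1)
    (hg : constantCoeff g = 1) :
    (momentSeries (fockLaw (sModel true f * sModel false g))).subst
      (X * (f * g * (1 + X))⁻¹) * (f * g) = f * g * (1 + X) := by
  -- Chosen so that `1 + K = (1 + cre true) (1 + cre false)`.
  let K := cre true + (1 + cre true) * cre false
  have hff : ann false * K = 1 := by
    simp only [K]
    rw [mul_add, ← mul_assoc, mul_add, ann_mul_cre_of_ne (by simp), zero_add, add_zero, mul_one,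
      ann_mul_cre_self]
  have htt : ann true * K = 1 + cre false := by
    simp only [K]
    rw [mul_add, ← mul_assoc, mul_add, ann_mul_cre_self, add_mul, mul_one,
      ann_mul_cre_of_ne (by simp), zero_add, one_mul]
  refine momentSeries_subst_of_genSeries_mul (K := K) (fun x => ?_) (by simp [hf, hg]) fun θ => ?_
  · simp [K, add_mul, vacCoeff_cre]
  · have h1 := genSeries_comp_annSeries_orbit hff g
      (θ ∘ₗ ((1 + cre true) * annSeries true f * (1 + cre false)))
    -- Here `ω` itself need not be an eigenvector of `ann true`, but `(1 + cre false) ω` is, because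
    -- `ann true * K = 1 + cre false`.
    have h2 := genSeries_comp_seriesEnd f (ann_locally_nilpotent true)
      (w := fun n => (1 + cre false) ((K ^ n) vac))
      (by
        rw [← Module.End.mul_apply, mul_add, ann_mul_cre_of_ne (by simp)]
        simp [ann_vac])
      (fun n => by
        rw [← Module.End.mul_apply (ann true), mul_add, ann_mul_cre_of_ne (by simp), add_zero,
          mul_one, pow_succ', Module.End.mul_apply, ← Module.End.mul_apply (ann true), htt])
      (θ ∘ₗ (1 + cre true))
    have h3 : (1 + cre true) * (1 + cre false) = 1 + K := by
      simp only [K]; noncomm_ring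
    have h4 : sModel true f * sModel false g =
        ((1 + cre true) * annSeries true f * (1 + cre false)) * annSeries false g := by
      simp only [sModel, mul_assoc]
    have h5 : genSeries (θ ∘ₗ ((1 + cre true) * annSeries true f * (1 + cre false)))
        (fun n => (K ^ n) vac) = f * genSeries (θ ∘ₗ (1 + K)) (fun n => (K ^ n) vac) := by
      rw [← h3]
      exact h2
    rw [mul_comm f g, mul_assoc, ← h5, ← h1, h4]
    rfl

/-! ### Free convolution linearizes under the transforms -/

theorem RTransform_bijective : Function.Bijective RTransform :=
  ⟨RTransform_injective, fun f => ⟨_, RTransform_law_rModel true f⟩⟩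

theorem law_rModel_RTransform (i : Bool) (μ : Law) :
    fockLaw (rModel i (RTransform μ)) = μ :=
  RTransform_injective (RTransform_law_rModel i _)

theorem freePair_rModel (f g : PowerSeries ℂ) :
    FreePair (A := Module.End ℂ Fock) vacState (rModel true f) (rModel false g) :=
  freePair_of_mem_leftAlg (rModel_mem_leftAlg _ _) (rModel_mem_leftAlg _ _)

theorem freePair_sModel (f g : PowerSeries ℂ) :
    FreePair (A := Module.End ℂ Fock) vacState (sModel true f) (sModel false g) :=
  freePair_of_mem_leftAlg (sModel_mem_leftAlg _ _) (sModel_mem_leftAlg _ _)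

theorem exists_freePair (μ ν : Law) : ∃ (A : Type) (_ : Ring A) (_ : Algebra ℂ A)
    (φ : A →ₗ[ℂ] ℂ) (hφ : φ 1 = 1) (a b : A),
    FreePair φ a b ∧ law φ hφ a = μ ∧ law φ hφ b = ν :=
  ⟨Module.End ℂ Fock, Module.End.instRing, Module.End.instAlgebra ℂ ℂ Fock, vacState, vacState_one,
    _, _, freePair_rModel (RTransform μ) (RTransform ν),
    law_rModel_RTransform _ _, law_rModel_RTransform _ _⟩

theorem exists_isFreeAddConv (μ ν : Law) : ∃ ρ, IsFreeAddConv μ ν ρ := by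
  obtain ⟨A, i, j, φ, hφ, a, b, h, ha, hb⟩ := exists_freePair μ ν
  exact ⟨_, A, i, j, φ, hφ, a, b, h, ha, hb, rfl⟩

theorem exists_isFreeMulConv (μ ν : Law) : ∃ ρ, IsFreeMulConv μ ν ρ := by
  obtain ⟨A, i, j, φ, hφ, a, b, h, ha, hb⟩ := exists_freePair μ ν
  exact ⟨_, A, i, j, φ, hφ, a, b, h, ha, hb, rfl⟩

theorem RTransform_boxplus (μ ν : Law) :
    RTransform (boxplus μ ν) = RTransform μ + RTransform ν := by
  have h := (freePair_rModel (RTransform μ) (RTransform ν)).fockLaw_add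
    (exists_isFreeAddConv _ _)
  rw [law_rModel_RTransform, law_rModel_RTransform] at h
  rw [← h, RTransform_law_rModel_add]

/-- The vacuum distribution of `sModel i f`. -/
noncomputable def sModelLaw (i : Bool) (f : PowerSeries ℂ) (hf : constantCoeff f = 1) :
    MeanOneLaw :=
  ⟨fockLaw (sModel i f), moment_one_eq_one hf (momentSeries_subst_sModel i hf)⟩

theorem STransform_sModelLaw (i : Bool) (f : PowerSeries ℂ) (hf : constantCoeff f = 1) :
    (STransform (sModelLaw i f hf)).1 = f⁻¹ :=
  STransform_eq_of_subst hf (momentSeries_subst_sModel i hf)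

theorem Lam.constantCoeff_inv (f : Lam) : constantCoeff f.1⁻¹ = 1 := by
  rw [PowerSeries.constantCoeff_inv, f.2, inv_one]

theorem Lam.inv_inv (f : Lam) : f.1⁻¹⁻¹ = f.1 := inv_inv_of_constantCoeff_ne_zero (by simp [f.2])

theorem STransform_sModelLaw_inv (i : Bool) (f : Lam) :
    STransform (sModelLaw i f.1⁻¹ f.constantCoeff_inv) = f :=
  Subtype.ext ((STransform_sModelLaw ..).trans f.inv_inv)

theorem STransform_bijective : Function.Bijective STransform :=
  ⟨STransform_injective, fun f => ⟨_, STransform_sModelLaw_inv true f⟩⟩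

/-- Model the two laws with the inverses `f`, `g` of their `S`-transforms. The product of the models
satisfies the single-model identity with `f * g`, which gives both mean one and `S`-transform `1 /
(f g)`. -/
theorem exists_STransform_boxtimes (μ ν : MeanOneLaw) :
    ∃ ρ : MeanOneLaw, ρ.1 = boxtimes μ ν ∧ STransform ρ = lamAdd (STransform μ) (STransform ν) := by
  obtain ⟨f, hf1, hμ, hf⟩ : ∃ (f : PowerSeries ℂ) (hf : constantCoeff f = 1),
      sModelLaw true f hf = μ ∧ f⁻¹ = (STransform μ).1 :=
    ⟨_, (STransform μ).constantCoeff_inv, STransform_injective (STransform_sModelLaw_inv _ _),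
      Lam.inv_inv _⟩
  obtain ⟨g, hg1, hν, hg⟩ : ∃ (g : PowerSeries ℂ) (hg : constantCoeff g = 1),
      sModelLaw false g hg = ν ∧ g⁻¹ = (STransform ν).1 :=
    ⟨_, (STransform ν).constantCoeff_inv, STransform_injective (STransform_sModelLaw_inv _ _),
      Lam.inv_inv _⟩
  have h := (freePair_sModel f g).fockLaw_mul (exists_isFreeMulConv _ _)
  have hfg : constantCoeff (f * g) = 1 := by rw [map_mul, hf1, hg1, one_mul]
  have hm := momentSeries_subst_sModel_mul hf1 hg1
  let ρ : MeanOneLaw := ⟨fockLaw (sModel true f * sModel false g), moment_one_eq_one hfg hm⟩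
  refine ⟨ρ, ?_, Subtype.ext ((STransform_eq_of_subst (μ := ρ) hfg hm).trans ?_)⟩
  · rw [← hμ, ← hν]
    exact h
  · rw [PowerSeries.mul_inv_rev, hf, hg, mul_comm]
    rfl

/-- Two signs cancel on the right and one remains on the left: this is why `LOG'` is multiplicative
only up to sign. -/
theorem dlog_lamMul (f g : Lam) : dlog (lamMul f g) = - hadamard (dlog f) (dlog g) := by
  have h := ghost_lamMul f g
  rw [ghost, neg_eq_iff_eq_neg] at h
  rw [h, ghost, ghost]
  congr 1
  ext
  simp [hadamard]

theorem ghost_isRingIso : IsRingIso lamAdd lamMul lamZero lamOne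
    (fun f g : PowerSeries ℂ => f + g) hadamard 0 hadamardOne ghostEquiv :=
  ⟨ghostEquiv.bijective, ghost_lamAdd, ghost_lamMul, ghost_lamZero, ghost_lamOne⟩

end Transforms

end FreeWitt

/-! ### Assembly of the rings and isomorphisms -/

theorem theorem2 :
    -- free convolutions are well defined: free pairs with given distributions exist, and the
    -- distributions of their sum and product depend only on the two given distributions
    (∀ μ ν : Law, ∃ (A : Type) (_ : Ring A) (_ : Algebra ℂ A) (φ : A →ₗ[ℂ] ℂ) (hφ : φ 1 = 1)
        (a b : A), FreePair φ a b ∧ law φ hφ a = μ ∧ law φ hφ b = ν) ∧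
    (∀ (A : Type u) [Ring A] [Algebra ℂ A] (φ : A →ₗ[ℂ] ℂ) (hφ : φ 1 = 1) (a b : A),
        FreePair φ a b →
          law φ hφ (a + b) = boxplus (law φ hφ a) (law φ hφ b) ∧
          law φ hφ (a * b) = boxtimes (law φ hφ a) (law φ hφ b)) ∧
    -- `Λ(ℂ)` and `ℂ[[z]]` with the Hadamard product are commutative unital rings
    IsCommUnitalRing lamAdd lamMul lamZero lamOne ∧
    IsCommUnitalRing (fun f g : PowerSeries ℂ => f + g) hadamard 0 hadamardOne ∧
    -- the transforms are bijections, and `⊠` restricts to an operation on the laws of mean one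
    ∃ (S : MeanOneLaw ≃ Lam) (R : Law ≃ PowerSeries ℂ) (gh : Lam ≃ PowerSeries ℂ)
      (tms : MeanOneLaw → MeanOneLaw → MeanOneLaw),
      (∀ μ, S μ = STransform μ) ∧ (∀ μ, R μ = RTransform μ) ∧ (∀ f, gh f = ghost f) ∧
      (∀ μ ν, (tms μ ν : Law) = boxtimes μ ν) ∧
      ∃ (ast : MeanOneLaw → MeanOneLaw → MeanOneLaw) (dot : Law → Law → Law)
        (zero₁ one₁ : MeanOneLaw) (zero one : Law) (LOG : MeanOneLaw → Law)
        (EXP : Law → MeanOneLaw),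
        -- the first ring
        IsCommUnitalRing tms ast zero₁ one₁ ∧
        IsRingIso tms ast zero₁ one₁ lamAdd lamMul lamZero lamOne S ∧
        (∀ μ ν, ast μ ν = S.symm (lamMul (S μ) (S ν))) ∧
        -- the second ring
        IsCommUnitalRing boxplus dot zero one ∧
        IsRingIso boxplus dot zero one (fun f g : PowerSeries ℂ => f + g) hadamard 0 hadamardOne
          R ∧
        (∀ μ ν, dot μ ν = R.symm (hadamard (R μ) (R ν))) ∧
        -- the two rings are isomorphic via `LOG` and `EXP`
        (∀ μ, LOG μ = R.symm (gh (S μ))) ∧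
        (∀ μ, EXP μ = S.symm (gh.symm (R μ))) ∧
        Function.LeftInverse EXP LOG ∧ Function.RightInverse EXP LOG ∧
        IsRingIso tms ast zero₁ one₁ boxplus dot zero one LOG ∧
        IsRingIso boxplus dot zero one tms ast zero₁ one₁ EXP ∧
        -- the same map with `d/dz log` in place of `- d/dz log`
        (∃ LOG' : MeanOneLaw → Law, (∀ μ, LOG' μ = R.symm (dlog (S μ))) ∧
          Function.Bijective LOG' ∧
          (∀ μ ν, LOG' (tms μ ν) = boxplus (LOG' μ) (LOG' ν)) ∧
          (∀ μ, boxplus (LOG' μ) (LOG μ) = zero) ∧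
          (∀ μ ν, boxplus (LOG' (ast μ ν)) (dot (LOG' μ) (LOG' ν)) = zero)) := by
  refine ⟨exists_freePair, fun A _ _ φ hφ a b h =>
    ⟨h.law_add_eq_boxplus hφ (exists_isFreeAddConv _ _),
      h.law_mul_eq_boxtimes hφ (exists_isFreeMulConv _ _)⟩,
    isCommUnitalRing_lam, isCommUnitalRing_hadamard, ?_⟩
  choose tms htms hS using exists_STransform_boxtimes
  let S : MeanOneLaw ≃ Lam := Equiv.ofBijective STransform STransform_bijective
  let R : Law ≃ PowerSeries ℂ := Equiv.ofBijective RTransform RTransform_bijective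
  let ast : MeanOneLaw → MeanOneLaw → MeanOneLaw := fun μ ν => S.symm (lamMul (S μ) (S ν))
  let dot : Law → Law → Law := fun μ ν => R.symm (hadamard (R μ) (R ν))
  have hS' : ∀ μ ν, S (tms μ ν) = lamAdd (S μ) (S ν) := hS
  have hR' : ∀ μ ν, R (boxplus μ ν) = R μ + R ν := RTransform_boxplus
  have hast : ∀ μ ν, S (ast μ ν) = lamMul (S μ) (S ν) := fun _ _ => S.apply_symm_apply _
  have hdot : ∀ μ ν, R (dot μ ν) = hadamard (R μ) (R ν) := fun _ _ => R.apply_symm_apply _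
  have isoS : IsRingIso tms ast (S.symm lamZero) (S.symm lamOne) lamAdd lamMul lamZero lamOne S :=
    ⟨S.bijective, hS', hast, S.apply_symm_apply _, S.apply_symm_apply _⟩
  have isoR : IsRingIso boxplus dot (R.symm 0) (R.symm hadamardOne)
      (fun f g : PowerSeries ℂ => f + g) hadamard 0 hadamardOne R :=
    ⟨R.bijective, hR', hdot, R.apply_symm_apply _, R.apply_symm_apply _⟩
  refine ⟨S, R, ghostEquiv, tms, fun _ => rfl, fun _ => rfl, fun _ => rfl, htms,
    ast, dot, S.symm lamZero, S.symm lamOne, R.symm 0, R.symm hadamardOne,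
    R.symm ∘ ghostEquiv ∘ S, S.symm ∘ ghostEquiv.symm ∘ R,
    isCommUnitalRing_lam.of_equiv S hS' hast, isoS, fun _ _ => rfl,
    isCommUnitalRing_hadamard.of_equiv R hR' hdot, isoR, fun _ _ => rfl, fun _ => rfl,
    fun _ => rfl, fun _ => by simp, fun _ => by simp,
    (isoS.trans ghost_isRingIso).trans isoR.symm,
    (isoR.trans ghost_isRingIso.symm).trans isoS.symm,
    R.symm ∘ dlog ∘ S, fun _ => rfl,
    R.symm.bijective.comp (Function.Bijective.comp ⟨dlog_injective, dlog_surjective⟩ S.bijective),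
    fun μ ν => ?_, fun μ => ?_, fun μ ν => ?_⟩
  all_goals apply R.injective
  · simp [hR', hS', dlog_lamAdd]
  · simp only [hR', Function.comp_apply, R.apply_symm_apply]
    exact add_neg_cancel _
  · simp [hR', hdot, hast, dlog_lamMul]
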